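/- Let $n \ge 1$ and let $K \subseteq \mathbb{R}^n$ be a compact convex set of positive volume, $V_n(K) > 0$, where $V_n$ denotes $n$-dimensional Euclidean volume. Then there exist an $n$-dimensional simplex $\triangle \subseteq \mathbb{R}^n$ (the convex hull of $n+1$ affinely independent points) and a real number $t \in (0,1)$ such that the Minkowski combination $$L = (1-t)\triangle + tK = \{(1-t)x + ty \;:\; x \in \triangle,\ y \in K\}$$ has the following two properties: (i) for every unit vector $u \in \mathbb{R}^n$, the orthogonal projection $\triangle_u$ of $\triangle$ onto the subspace $u^\perp$ contains a translate of the orthogonal projection $L_u$ of $L$ onto $u^\perp$; that is, there is $w \in u^\perp$ with $L_u + w \subseteq \triangle_u$; (ii) $V_n(L) > V_n(\triangle)$. -/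

import Mathlib

open MeasureTheory
open scoped Pointwise

/-- The orthogonal projection `K_u` of a set `K` onto the subspace `u^⊥`,
regarded as a subset of the ambient Euclidean space. -/
noncomputable def shadow {n : ℕ} (u : EuclideanSpace ℝ (Fin n))
    (K : Set (EuclideanSpace ℝ (Fin n))) : Set (EuclideanSpace ℝ (Fin n)) :=
  (Submodule.span ℝ {u})ᗮ.starProjection '' K

/-- For every unit vector `u`, the projection of `M` onto `u^⊥` contains a translate
(within `u^⊥`) of the projection of `L` onto `u^⊥`. -/
def ShadowsContainTranslates {n : ℕ} (M L : Set (EuclideanSpace ℝ (Fin n))) : Prop :=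
  ∀ u : EuclideanSpace ℝ (Fin n), ‖u‖ = 1 →
    ∃ w ∈ (Submodule.span ℝ {u})ᗮ, ∀ x ∈ shadow u L, x + w ∈ shadow u M

/-! Circumscribe about `K` a simplex S such that `K` meets every facet but no point of `K` lies on
two facets (`exists_circumscribed_affineBasis`). By compactness any two barycentric coordinates of S
then sum to at least some m > 0 on `K`. Take △ to be S shrunk by the factor 1 - m.

Shadows: given u, let k be the coordinate changing fastest along u. Sliding a point of `K` along u
until coordinate k reaches m costs every other coordinate at most the amount gained, so it stays
nonnegative. Thus `K` slides into the copy of △ at vertex k, a translate of △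
(`AffineBasis.exists_forall_add_smul_mem`).

Volume: (1 - t)△ + tS exceeds △ in volume to first order in t. Replacing S by `K` loses only points
within O(t) of two facets, of volume O(t²), so small t works.

To find S, consider an inscribed simplex of maximal volume: the hyperplanes through its vertices
parallel to the opposite facets support `K`, but may touch it elsewhere. Adding a small multiple of
the scatter, strictly convex in each vertex, tilts them so that each touches `K` at its vertex only.
-/

/-! ### Measure of the region near two facets -/

theorem AffineBasis.coord_linear_eq_basisOf_coord {ι E : Type*} [AddCommGroup E] [Module ℝ E]
    (b : AffineBasis ι ℝ E) {k l : ι} (hl : l ≠ k) :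
    (b.coord l).linear = (b.basisOf k).coord ⟨l, hl⟩ := by
  classical
  refine (b.basisOf k).ext fun j => ?_
  rw [Module.Basis.coord_apply, Module.Basis.repr_self, AffineBasis.basisOf_apply,
    AffineMap.linearMap_vsub, AffineBasis.coord_apply, AffineBasis.coord_apply, if_neg hl,
    Finsupp.single_apply]
  simp [Subtype.ext_iff, eq_comm]

/-- The set of points two of whose barycentric coordinates are confined to intervals of length `t`
and the others to unit intervals has measure `O(t ^ 2)`, uniformly in the intervals. -/
theorem AffineBasis.exists_measure_coord_box_le {ι E : Type*} [Fintype ι] [NormedAddCommGroup E]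
    [NormedSpace ℝ E] [FiniteDimensional ℝ E] [MeasurableSpace E] [BorelSpace E]
    (μ : Measure E) [μ.IsAddHaarMeasure]
    (b : AffineBasis ι ℝ E) {i j k : ι} (hij : i ≠ j) (hik : i ≠ k) (hjk : j ≠ k) :
    ∃ C : ℝ, 0 ≤ C ∧ ∀ (a : ι → ℝ) (t : ℝ), 0 ≤ t →
      μ {z | (∀ l, a l ≤ b.coord l z ∧ b.coord l z ≤ a l + 1) ∧
        b.coord i z ≤ a i + t ∧ b.coord j z ≤ a j + t} ≤ ENNReal.ofReal (C * t ^ 2) := by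
  classical
  -- Dropping coordinate `k`, which is neither `i` nor `j`, keeps both short sides of the box.
  let φ : E ≃L[ℝ] ({l // l ≠ k} → ℝ) := (b.basisOf k).equivFunL
  let c := Measure.addHaarScalarFactor (μ.map φ) volume
  refine ⟨c, c.2, fun a t ht => ?_⟩
  let r : {l // l ≠ k} → ℝ := fun l => if l.1 = i ∨ l.1 = j then t else 1
  let a' : {l // l ≠ k} → ℝ := fun l => a l - b.coord l (b k)
  have hsub : {z | (∀ l, a l ≤ b.coord l z ∧ b.coord l z ≤ a l + 1) ∧
        b.coord i z ≤ a i + t ∧ b.coord j z ≤ a j + t} ⊆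
      (fun z => z - b k) ⁻¹' (φ ⁻¹' Set.Icc a' (a' + r)) := by
    rintro z ⟨h1, h2, h3⟩
    have hz : ∀ l : {l // l ≠ k}, φ (z - b k) l = b.coord l z - b.coord l (b k) := by
      intro l
      have := (b.coord l).linearMap_vsub z (b k)
      rw [b.coord_linear_eq_basisOf_coord l.2] at this
      exact this
    simp only [Set.mem_preimage, Set.mem_Icc, Pi.le_def, Pi.add_apply, hz, a', r]
    refine ⟨fun l => by linarith [(h1 l).1], fun l => ?_⟩
    split_ifs with h
    · rcases h with h | h <;> rw [h] <;> linarith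
    · linarith [(h1 l).2]
  have hμ : μ.map φ = c • volume := Measure.isAddLeftInvariant_eq_smul _ _
  have hr : ∏ l, ENNReal.ofReal (r l) = ENNReal.ofReal (t ^ 2) := by
    have hne : (⟨i, hik⟩ : {l // l ≠ k}) ≠ ⟨j, hjk⟩ := fun h => hij (congrArg Subtype.val h)
    rw [← Finset.prod_subset (Finset.subset_univ {⟨i, hik⟩, ⟨j, hjk⟩}), Finset.prod_pair hne]
    · simp [r, sq, ENNReal.ofReal_mul ht]
    · intro l _ hl
      simp only [Finset.mem_insert, Finset.mem_singleton, Subtype.ext_iff] at hl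
      simp [r, hl]
  calc _ ≤ μ ((fun z => z - b k) ⁻¹' (φ ⁻¹' Set.Icc a' (a' + r))) := measure_mono hsub
    _ = μ (φ ⁻¹' Set.Icc a' (a' + r)) := by
      simp only [sub_eq_add_neg]; exact measure_preimage_add_right _ _ _
    _ = μ.map φ (Set.Icc a' (a' + r)) :=
      (φ.toHomeomorph.toMeasurableEquiv.map_apply _).symm
    _ = c * ENNReal.ofReal (t ^ 2) := by
      rw [hμ, Measure.smul_apply, Real.volume_Icc_pi]
      simp only [Pi.add_apply, add_sub_cancel_left, hr]; rfl
    _ = ENNReal.ofReal (c * t ^ 2) := by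
      rw [ENNReal.ofReal_mul (NNReal.coe_nonneg c), ENNReal.ofReal_coe_nnreal]

/-- Covers dimension one as well: with no third index, the two coordinates sum to 1, and the bound
on `∑ l, a l + 2 * t` leaves the set empty. -/
theorem AffineBasis.exists_measure_coord_lt_le {ι E : Type*} [Fintype ι] [NormedAddCommGroup E]
    [NormedSpace ℝ E] [FiniteDimensional ℝ E] [MeasurableSpace E] [BorelSpace E]
    (μ : Measure E) [μ.IsAddHaarMeasure] (b : AffineBasis ι ℝ E) {i j : ι} (hij : i ≠ j) :
    ∃ C : ℝ, 0 ≤ C ∧ ∀ (a : ι → ℝ) (t : ℝ), 0 ≤ t → ∑ l, a l + 2 * t < 1 →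
      μ {z | (∀ l, a l ≤ b.coord l z ∧ b.coord l z ≤ a l + 1) ∧
        b.coord i z < a i + t ∧ b.coord j z < a j + t} ≤ ENNReal.ofReal (C * t ^ 2) := by
  classical
  by_cases h : ∃ k, i ≠ k ∧ j ≠ k
  · obtain ⟨k, hik, hjk⟩ := h
    obtain ⟨C, hC, H⟩ := b.exists_measure_coord_box_le μ hij hik hjk
    refine ⟨C, hC, fun a t ht _ => le_trans (measure_mono ?_) (H a t ht)⟩
    exact fun z hz => ⟨hz.1, hz.2.1.le, hz.2.2.le⟩
  · refine ⟨0, le_rfl, fun a t _ hat => ?_⟩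
    have huniv : (Finset.univ : Finset ι) = {i, j} := by
      ext k
      simp only [Finset.mem_univ, Finset.mem_insert, Finset.mem_singleton, true_iff]
      by_contra hk
      push Not at hk
      exact h ⟨k, hk.1.symm, hk.2.symm⟩
    refine le_of_eq_of_le ?_ (zero_le (a := ENNReal.ofReal (0 * t ^ 2)))
    rw [← measure_empty (μ := μ)]
    congr 1
    rw [Set.eq_empty_iff_forall_notMem]
    rintro z ⟨-, h1, h2⟩
    have := b.sum_coord_apply_eq_one z
    rw [huniv, Finset.sum_pair hij] at this hat
    linarith

/-! ### The circumscribed simplex -/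

/-- `#ι` times the total squared distance of `x` from its mean. -/
noncomputable def scatter {ι E : Type*} [Fintype ι] [NormedAddCommGroup E] (x : ι → E) : ℝ :=
  Fintype.card ι * ∑ i, ‖x i‖ ^ 2 - ‖∑ i, x i‖ ^ 2

section
variable {ι E : Type*} [Fintype ι] [DecidableEq ι] [NormedAddCommGroup E] [InnerProductSpace ℝ E]

omit [DecidableEq ι] [InnerProductSpace ℝ E] in
theorem continuous_scatter : Continuous (scatter : (ι → E) → ℝ) := by
  unfold scatter; fun_prop

/-- The last term is the quadratic gap that makes contact with `K` unique; the middle one is the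
tilt of the supporting hyperplane. -/
theorem scatter_update (x : ι → E) (i : ι) (y : E) :
    scatter (Function.update x i y) = scatter x +
      2 * inner ℝ ((Fintype.card ι : ℝ) • x i - ∑ j, x j) (y - x i) +
      (Fintype.card ι - 1) * ‖y - x i‖ ^ 2 := by
  have h1 : ∑ j, Function.update x i y j = (∑ j, x j) + (y - x i) := by
    rw [Finset.sum_update_of_mem (Finset.mem_univ i),
      Finset.sum_eq_add_sum_sdiff_singleton_of_mem (Finset.mem_univ i) x]
    abel
  have h2 : ∑ j, ‖Function.update x i y j‖ ^ 2 = (∑ j, ‖x j‖ ^ 2) + (‖y‖ ^ 2 - ‖x i‖ ^ 2) := by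
    have : (fun j => ‖Function.update x i y j‖ ^ 2) =
        Function.update (fun j => ‖x j‖ ^ 2) i (‖y‖ ^ 2) := by
      ext j; by_cases h : j = i
      · subst h; simp
      · simp [h]
    rw [this, Finset.sum_update_of_mem (Finset.mem_univ i),
      Finset.sum_eq_add_sum_sdiff_singleton_of_mem (Finset.mem_univ i) (fun j => ‖x j‖ ^ 2)]
    ring
  have h3 : ‖y‖ ^ 2 - ‖x i‖ ^ 2 = 2 * inner ℝ (x i) (y - x i) + ‖y - x i‖ ^ 2 := by
    have := norm_add_sq_real (x i) (y - x i)
    rw [add_sub_cancel] at this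
    linarith
  have h4 := norm_add_sq_real (∑ j, x j) (y - x i)
  simp only [scatter, h1, h2, h3, h4, inner_sub_left, real_inner_smul_left]
  ring

theorem AffineBasis.det_toMatrix_update (β x : AffineBasis ι ℝ E) (i : ι) (y : E) :
    (β.toMatrix (Function.update x i y)).det = (β.toMatrix x).det * x.coord i y := by
  have h := congrFun (β.det_smul_coords_eq_cramer_coords x y) i
  rw [Matrix.cramer_apply, Matrix.updateCol_transpose, Matrix.det_transpose] at h
  simp only [Pi.smul_apply, smul_eq_mul, AffineBasis.coords_apply] at h
  rw [h]
  congr 1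
  ext j k
  by_cases hj : j = i
  · subst hj; simp [AffineBasis.toMatrix_apply]
  · simp [hj, AffineBasis.toMatrix_apply]

/-- Maximizing the signed volume plus a small multiple of the scatter over all simplices with
vertices in a compact set. -/
theorem exists_affineBasis_isMax [FiniteDimensional ℝ E] {K : Set E} (hK : IsCompact K)
    (β : AffineBasis ι ℝ E) (hβ : ∀ i, β i ∈ K) :
    ∃ (x : AffineBasis ι ℝ E) (D ε : ℝ), 0 < D ∧ 0 < ε ∧ (∀ i, x i ∈ K) ∧ ∀ i, ∀ y ∈ K,
      D * x.coord i y + ε * scatter (Function.update x i y) ≤ D + ε * scatter x := by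
  have hKc : IsCompact (Set.univ.pi fun _ : ι => K) := isCompact_univ_pi fun _ => hK
  have hβK : (β : ι → E) ∈ Set.univ.pi fun _ : ι => K := fun i _ => hβ i
  obtain ⟨C, hC⟩ := hKc.exists_bound_of_continuousOn (continuous_scatter (E := E)).continuousOn
  have hC0 : 0 ≤ C := (norm_nonneg _).trans (hC _ hβK)
  set ε : ℝ := 1 / (4 * (C + 1)) with hε
  have hεpos : 0 < ε := by positivity
  have hεC : ε * C ≤ 1 / 4 := by
    rw [hε, div_mul_eq_mul_div, div_le_div_iff₀ (by positivity) (by norm_num)]; linarith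
  have hcont : Continuous fun p : ι → E => (β.toMatrix p).det + ε * scatter p := by
    refine Continuous.add (Continuous.matrix_det ?_) (continuous_const.mul continuous_scatter)
    refine continuous_matrix fun i j => ?_
    exact (continuous_barycentric_coord β j).comp (continuous_apply i)
  obtain ⟨p, hp, hmax⟩ := hKc.exists_isMaxOn ⟨_, hβK⟩ hcont.continuousOn
  have hb : ∀ q ∈ Set.univ.pi fun _ : ι => K, |ε * scatter q| ≤ 1 / 4 := fun q hq => by
    rw [abs_mul, abs_of_pos hεpos]
    exact (mul_le_mul_of_nonneg_left (hC q hq) hεpos.le).trans hεC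
  -- The competitor `β` has determinant 1 and both scatter terms are at most 1/4 in absolute value,
  -- so the maximizer has determinant at least 1/2.
  have hD : 0 < (β.toMatrix p).det := by
    have h := hmax hβK
    simp only [Set.mem_ofPred_eq, AffineBasis.toMatrix_self, Matrix.det_one] at h
    linarith [abs_le.1 (hb _ hβK), abs_le.1 (hb _ hp)]
  obtain ⟨hind, htop⟩ := (β.isUnit_toMatrix_iff p).1
    ((Matrix.isUnit_iff_isUnit_det _).2 hD.ne'.isUnit)
  let x : AffineBasis ι ℝ E := ⟨p, hind, htop⟩
  refine ⟨x, _, ε, hD, hεpos, fun i => hp i trivial, fun i y hy => ?_⟩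
  have hq : Function.update p i y ∈ Set.univ.pi fun _ : ι => K := by
    intro j _
    by_cases hj : j = i
    · subst hj; simpa using hy
    · simpa [hj] using hp j trivial
  have h := hmax hq
  have hx := β.det_toMatrix_update x i y
  change (β.toMatrix (Function.update p i y)).det = (β.toMatrix p).det * x.coord i y at hx
  simp only [Set.mem_ofPred_eq, hx] at h
  exact h

/-- Affine functions with positive constant sum, as many as the vertices of a simplex, and jointly
injective, are proportional to barycentric coordinates. -/
theorem exists_affineBasis_coord_eq [FiniteDimensional ℝ E] (β : AffineBasis ι ℝ E)
    (l : ι → E →ᵃ[ℝ] ℝ) {H : ℝ} (hH : 0 < H) (hsum : ∀ y, ∑ i, l i y = H)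
    (hinj : ∀ v, (∀ i, (l i).linear v = 0) → v = 0) :
    ∃ b : AffineBasis ι ℝ E, ∀ i y, b.coord i y = l i y / H := by
  have hcard : Fintype.card ι = Module.finrank ℝ E + 1 := β.card_eq_finrank_add_one
  let Φ : E →ₗ[ℝ] ι → ℝ := LinearMap.pi fun i => (l i).linear
  have hlin : ∀ i y, l i y = (l i).linear y + l i 0 := fun i y => by
    have := (l i).linearMap_vsub y 0
    simp only [vsub_eq_sub, sub_zero] at this; linarith
  have hsum0 : ∑ i, l i 0 = H := hsum 0
  have hlsum : ∀ v, ∑ i, (l i).linear v = 0 := fun v => by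
    have := hsum v
    simp only [hlin _ v, Finset.sum_add_distrib, hsum0] at this; linarith
  have hΦ : Function.Injective Φ := by
    rw [← LinearMap.ker_eq_bot, LinearMap.ker_eq_bot']
    exact fun v hv => hinj v fun i => congrFun hv i
  let σ : (ι → ℝ) →ₗ[ℝ] ℝ := ∑ i, LinearMap.proj i
  have hσ : ∀ w, σ w = ∑ i, w i := fun w => by simp [σ]
  obtain ⟨i₀⟩ := β.nonempty
  have hσsurj : Function.Surjective σ := fun c => ⟨Pi.single i₀ c, by rw [hσ]; simp⟩
  -- The linear parts sum to zero, and a dimension count gives equality; hence the vertices can be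
  -- found by prescribing the values of all `l j`.
  have hrange : LinearMap.range Φ = LinearMap.ker σ := by
    refine Submodule.eq_of_le_of_finrank_eq ?_ ?_
    · rintro _ ⟨v, rfl⟩
      rw [LinearMap.mem_ker, hσ]; exact hlsum v
    · have h1 := σ.finrank_range_add_finrank_ker
      rw [LinearMap.range_eq_top.2 hσsurj, finrank_top, Module.finrank_self,
        Module.finrank_fintype_fun_eq_card] at h1
      rw [LinearMap.finrank_range_of_inj hΦ]; omega
  have hex : ∀ k, ∃ p : E, ∀ j, l j p = if j = k then H else 0 := by
    intro k
    have : (fun j => (if j = k then H else 0) - l j 0) ∈ LinearMap.range Φ := by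
      rw [hrange, LinearMap.mem_ker, hσ, Finset.sum_sub_distrib, hsum0]; simp
    obtain ⟨p, hp⟩ := this
    refine ⟨p, fun j => ?_⟩
    have := congrFun hp j
    simp only [Φ, LinearMap.pi_apply] at this
    rw [hlin, this]; ring
  choose p hp using hex
  have hind : AffineIndependent ℝ p := by
    rw [affineIndependent_iff_eq_of_fintype_affineCombination_eq]
    intro w₁ w₂ h₁ h₂ h
    have key : ∀ w : ι → ℝ, ∑ i, w i = 1 →
        ∀ j, l j (Finset.univ.affineCombination ℝ p w) = w j * H := fun w hw j => by
      rw [Finset.map_affineCombination _ _ _ hw,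
        Finset.affineCombination_eq_linear_combination _ _ _ hw]
      simp [hp]
    ext j
    have := key w₁ h₁ j
    rw [h, key w₂ h₂ j] at this
    exact (mul_right_cancel₀ hH.ne' this).symm
  let b : AffineBasis ι ℝ E := ⟨p, hind, hind.affineSpan_eq_top_iff_card_eq_finrank_add_one.2 hcard⟩
  refine ⟨b, fun i y => ?_⟩
  have h : l i y = b.coord i y * H := by
    conv_lhs => rw [← b.affineCombination_coord_eq_self y]
    rw [Finset.map_affineCombination _ _ _ (b.sum_coord_apply_eq_one y),
        Finset.affineCombination_eq_linear_combination _ _ _ (b.sum_coord_apply_eq_one y)]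
    change ∑ k, b.coord k y • l i (p k) = _
    simp [hp]
  rw [h, mul_div_cancel_right₀ _ hH.ne']

/-- A compact set containing the vertices of a nondegenerate simplex has a circumscribed simplex
which it touches in every facet but in no face of smaller dimension. -/
theorem exists_circumscribed_affineBasis [FiniteDimensional ℝ E] [Nontrivial ι] {K : Set E}
    (hK : IsCompact K) (β : AffineBasis ι ℝ E) (hβ : ∀ i, β i ∈ K) :
    ∃ b : AffineBasis ι ℝ E, (∀ i, ∀ y ∈ K, 0 ≤ b.coord i y) ∧
      (∀ i, ∃ y ∈ K, b.coord i y = 0) ∧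
      ∀ i j, i ≠ j → ∀ y ∈ K, 0 < b.coord i y + b.coord j y := by
  obtain ⟨x, D, ε, hD, hε, hxK, hmax⟩ := exists_affineBasis_isMax hK β hβ
  let N : ℝ := Fintype.card ι
  have hN : 1 < N := Nat.one_lt_cast.2 (Fintype.one_lt_card (α := ι))
  let S : E := ∑ j, x j
  let g : ι → E →ᵃ[ℝ] ℝ := fun i => (innerₛₗ ℝ (N • x i - S)).toAffineMap
  -- Maximality in the `i`-th vertex, with the quadratic term moved to the other side, bounds this
  -- affine function below on `K`.
  let l : ι → E →ᵃ[ℝ] ℝ := fun i =>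
    D • (AffineMap.const ℝ E 1 - x.coord i) - (2 * ε) • (g i - AffineMap.const ℝ E (g i (x i)))
  have hl : ∀ i y, l i y = D * (1 - x.coord i y) - 2 * ε * inner ℝ (N • x i - S) (y - x i) := by
    intro i y
    rw [inner_sub_right]; rfl
  have hlin : ∀ i v, (l i).linear v =
      -(D * (x.coord i).linear v) - 2 * ε * inner ℝ (N • x i - S) v := by
    intro i v
    change D * (0 - (x.coord i).linear v) - 2 * ε * (inner ℝ (N • x i - S) v - 0) = _
    ring
  have hcl : ∀ i v, (x.coord i).linear v = x.coord i v - x.coord i 0 := fun i v => by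
    have := (x.coord i).linearMap_vsub v 0
    rwa [vsub_eq_sub, sub_zero, vsub_eq_sub] at this
  have hlow : ∀ i, ∀ y ∈ K, ε * ((N - 1) * ‖y - x i‖ ^ 2) ≤ l i y := by
    intro i y hy
    have := hmax i y hy
    rw [scatter_update] at this
    rw [hl]
    change D * x.coord i y + ε * (scatter x + 2 * inner ℝ (N • x i - S) (y - x i) +
      (N - 1) * ‖y - x i‖ ^ 2) ≤ D + ε * scatter x at this
    linarith
  have hpos : ∀ i, ∀ y ∈ K, y ≠ x i → 0 < l i y := fun i y hy hne => by
    refine lt_of_lt_of_le ?_ (hlow i y hy)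
    have : 0 < ‖y - x i‖ := norm_pos_iff.2 (sub_ne_zero.2 hne)
    have : 0 < N - 1 := by linarith
    positivity
  have hself : ∀ i, l i (x i) = 0 := fun i => by rw [hl]; simp
  have hnn : ∀ i, ∀ y ∈ K, 0 ≤ l i y := fun i y hy => by
    by_cases h : y = x i
    · rw [h, hself]
    · exact (hpos i y hy h).le
  have hsumlin : ∀ v, ∑ i, (l i).linear v = 0 := by
    intro v
    have h1 : ∑ i, (x.coord i).linear v = 0 := by
      simp only [hcl, Finset.sum_sub_distrib, x.sum_coord_apply_eq_one, sub_self]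
    have h2 : ∑ i, inner ℝ (N • x i - S) v = 0 := by
      rw [← sum_inner, Finset.sum_sub_distrib, ← Finset.smul_sum]
      simp [S, N, Finset.card_univ, ← Nat.cast_smul_eq_nsmul ℝ]
    simp only [hlin, Finset.sum_sub_distrib, Finset.sum_neg_distrib, ← Finset.mul_sum, h1, h2,
      mul_zero, neg_zero, sub_zero]
  obtain ⟨i₀, i₁, h01⟩ := exists_pair_ne ι
  set H := ∑ i, l i (x i₀) with hHdef
  have hH : 0 < H := by
    refine Finset.sum_pos' (fun i _ => hnn i _ (hxK i₀)) ⟨i₁, Finset.mem_univ _, ?_⟩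
    exact hpos _ _ (hxK i₀) fun h => h01 (x.ind.injective h)
  have hsum : ∀ y, ∑ i, l i y = H := fun y => by
    have : ∀ i, l i y = (l i).linear (y - x i₀) + l i (x i₀) := fun i => by
      have := (l i).linearMap_vsub y (x i₀)
      simp only [vsub_eq_sub] at this; linarith
    simp [this, Finset.sum_add_distrib, hsumlin, hHdef]
  have hinj : ∀ v, (∀ i, (l i).linear v = 0) → v = 0 := by
    intro v hv
    let c : ι → ℝ := fun i => (x.coord i).linear v
    have hc : ∀ i, c i = x.coord i v - x.coord i 0 := fun i => hcl i v
    have hc0 : ∑ i, c i = 0 := by simp [hc, x.sum_coord_apply_eq_one]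
    have hcv : ∑ i, c i • x i = v := by
      simp only [hc, sub_smul, Finset.sum_sub_distrib, x.linear_combination_coord_eq_self, sub_zero]
    have h1 : ∑ i, c i * inner ℝ (N • x i - S) v = N * ‖v‖ ^ 2 := by
      have : ∑ i, c i • (N • x i - S) = N • v := by
        simp only [smul_sub, Finset.sum_sub_distrib, ← Finset.sum_smul, hc0, zero_smul, sub_zero,
          smul_comm _ N, ← Finset.smul_sum, hcv]
      rw [← real_inner_self_eq_norm_sq, ← real_inner_smul_left, ← this, sum_inner]
      simp only [real_inner_smul_left]
    -- Pairing the vanishing linear parts with the coordinates of `v` gives a sum of nonnegative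
    -- terms, one a positive multiple of `‖v‖ ^ 2`.
    have h2 : ∑ i, c i * (-(D * c i) - 2 * ε * inner ℝ (N • x i - S) v) = 0 :=
      Finset.sum_eq_zero fun i _ => by rw [← hlin, hv, mul_zero]
    have h3 : D * ∑ i, c i ^ 2 + 2 * ε * (N * ‖v‖ ^ 2) = 0 := by
      rw [← h1, Finset.mul_sum, Finset.mul_sum, ← Finset.sum_add_distrib, ← neg_eq_zero,
        ← Finset.sum_neg_distrib, ← h2]
      exact Finset.sum_congr rfl fun i _ => by ring
    have h4 : 0 ≤ D * ∑ i, c i ^ 2 := mul_nonneg hD.le (Finset.sum_nonneg fun i _ => sq_nonneg _)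
    by_contra hne
    have : 0 < ‖v‖ := norm_pos_iff.2 hne
    have : 0 < 2 * ε * (N * ‖v‖ ^ 2) := by positivity
    linarith
  obtain ⟨b, hb⟩ := exists_affineBasis_coord_eq β l hH hsum hinj
  refine ⟨b, fun i y hy => ?_, fun i => ⟨x i, hxK i, ?_⟩, fun i j hij y hy => ?_⟩
  · rw [hb]; exact div_nonneg (hnn i y hy) hH.le
  · rw [hb, hself, zero_div]
  · rw [hb, hb, ← add_div]
    refine div_pos ?_ hH
    by_cases h : y = x i
    · have := hpos j y hy fun h' => hij (x.ind.injective (h.symm.trans h'))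
      linarith [hnn i y hy]
    · linarith [hpos i y hy h, hnn j y hy]

end

/-! ### Sliding into homothetic copies and comparing volumes -/

section
variable {ι E : Type*} [Fintype ι] [DecidableEq ι] [NormedAddCommGroup E] [NormedSpace ℝ E]

omit [Fintype ι] in
theorem AffineBasis.coord_homothety (b : AffineBasis ι ℝ E) (k l : ι) (r : ℝ) (y : E) :
    b.coord l (AffineMap.homothety (b k) r y) =
      r * b.coord l y + (1 - r) * if l = k then 1 else 0 := by
  rw [AffineMap.homothety_eq_lineMap, AffineMap.apply_lineMap, AffineMap.lineMap_apply_module,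
    b.coord_apply]
  simp only [smul_eq_mul]; ring

omit [Fintype ι] in
theorem AffineBasis.mem_homothety_image_convexHull (b : AffineBasis ι ℝ E) (k : ι) {r : ℝ}
    (hr : 0 < r) {z : E} :
    z ∈ AffineMap.homothety (b k) r '' convexHull ℝ (Set.range b) ↔
      ∀ l, (1 - r) * (if l = k then 1 else 0) ≤ b.coord l z := by
  rw [b.convexHull_eq_nonneg_coord]
  constructor
  · rintro ⟨y, hy, rfl⟩ l
    rw [b.coord_homothety]
    have := mul_nonneg hr.le (hy l)
    linarith
  · intro h
    refine ⟨AffineMap.homothety (b k) r⁻¹ z, fun l => ?_, ?_⟩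
    · rw [b.coord_homothety]
      have h1 := mul_le_mul_of_nonneg_left (h l) (inv_nonneg.2 hr.le)
      have h2 : r⁻¹ * ((1 - r) * if l = k then (1 : ℝ) else 0) =
          -((1 - r⁻¹) * if l = k then 1 else 0) := by
        field_simp; ring
      linarith
    · rw [← AffineMap.homothety_mul_apply, mul_inv_cancel₀ hr.ne', AffineMap.homothety_one]; rfl

omit [Fintype ι] in
-- Equal-ratio copies at different vertices are translates, so one fixed simplex serves all
-- directions.
theorem AffineBasis.sub_mem_homothety_image (b : AffineBasis ι ℝ E) (k k' : ι) {m : ℝ}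
    (hm : m < 1) {z : E} (hz : z ∈ AffineMap.homothety (b k) (1 - m) '' convexHull ℝ (Set.range b)) :
    z - m • (b k - b k') ∈ AffineMap.homothety (b k') (1 - m) '' convexHull ℝ (Set.range b) := by
  rw [b.mem_homothety_image_convexHull _ (by linarith)] at hz ⊢
  intro l
  have h : b.coord l (z - m • (b k - b k')) =
      b.coord l z - m * ((if l = k then 1 else 0) - if l = k' then 1 else 0) := by
    have h1 := (b.coord l).linearMap_vsub z (z - m • (b k - b k'))
    have h2 := (b.coord l).linearMap_vsub (b k) (b k')
    simp only [vsub_eq_sub, sub_sub_cancel, map_smul, smul_eq_mul, b.coord_apply] at h1 h2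
    rw [h2] at h1
    linarith
  rw [h]
  have := hz l
  linarith

/-- If no two barycentric coordinates are small simultaneously on `K`, then along any line
direction `K` can be slid into one of the translates of a smaller simplex. -/
theorem AffineBasis.exists_forall_add_smul_mem (b : AffineBasis ι ℝ E) {K : Set E}
    (hK : ∀ i, ∀ y ∈ K, 0 ≤ b.coord i y) {m : ℝ} (hm : m < 1)
    (hmK : ∀ i j, i ≠ j → ∀ y ∈ K, m ≤ b.coord i y + b.coord j y) {u : E} (hu : u ≠ 0) :
    ∃ k, ∀ y ∈ K, ∃ s : ℝ,
      y + s • u ∈ AffineMap.homothety (b k) (1 - m) '' convexHull ℝ (Set.range b) := by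
  have := b.nonempty
  obtain ⟨k, hk⟩ := Finite.exists_max fun i => |(b.coord i).linear u|
  have hadd : ∀ i (y : E) (s : ℝ), b.coord i (y + s • u) =
      b.coord i y + s * (b.coord i).linear u := fun i y s => by
    have := (b.coord i).map_vadd y (s • u)
    rw [vadd_eq_add, vadd_eq_add, map_smul, smul_eq_mul] at this
    rw [add_comm, this, add_comm]
  have hk0 : (b.coord k).linear u ≠ 0 := by
    intro h0
    apply hu
    refine b.ext_elem fun i => ?_
    have h1 := hk i
    simp only [h0, abs_zero, abs_nonpos_iff] at h1
    have := hadd i 0 1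
    rwa [h1, mul_zero, add_zero, zero_add, one_smul] at this
  refine ⟨k, fun y hy => ?_⟩
  simp only [b.mem_homothety_image_convexHull k (show 0 < 1 - m by linarith), sub_sub_cancel]
  by_cases hmy : m ≤ b.coord k y
  · refine ⟨0, fun l => ?_⟩
    rw [zero_smul, add_zero]
    split_ifs with h
    · rwa [h, mul_one]
    · rw [mul_zero]; exact hK l y hy
  · push Not at hmy
    refine ⟨(m - b.coord k y) / (b.coord k).linear u, fun l => ?_⟩
    rw [hadd]
    split_ifs with h
    · rw [h, div_mul_cancel₀ _ hk0]; linarith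
    · have h1 : |(m - b.coord k y) / (b.coord k).linear u * (b.coord l).linear u| ≤
          m - b.coord k y := by
        rw [abs_mul, abs_div, abs_of_pos (sub_pos.2 hmy), div_mul_eq_mul_div,
          div_le_iff₀ (abs_pos.2 hk0)]
        exact mul_le_mul_of_nonneg_left (hk l) (sub_pos.2 hmy).le
      have := hmK l k h y hy
      linarith [(abs_le.1 h1).1]

/-- A dilate of a simplex is covered by a Minkowski combination with a set touching its facets, up
to the points near two facets. -/
theorem AffineBasis.mem_add_or_exists_coord_lt (b : AffineBasis ι ℝ E) {K : Set E}
    (hK : ∀ i, ∀ y ∈ K, 0 ≤ b.coord i y) (htouch : ∀ i, ∃ y ∈ K, b.coord i y = 0)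
    (k₀ : ι) {m t : ℝ} (hm0 : 0 ≤ m) (hm : m < 1) (ht0 : 0 < t) (ht1 : t < 1) {z : E}
    (hz : z ∈ AffineMap.homothety (b k₀) (1 - (1 - t) * m) '' convexHull ℝ (Set.range b)) :
    z ∈ (1 - t) • (AffineMap.homothety (b k₀) (1 - m) '' convexHull ℝ (Set.range b)) + t • K ∨
    ∃ p : {p : ι × ι // p.1 ≠ p.2},
      b.coord p.1.1 z < (1 - t) * m * (if p.1.1 = k₀ then 1 else 0) + t ∧
      b.coord p.1.2 z < (1 - t) * m * (if p.1.2 = k₀ then 1 else 0) + t := by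
  have hlt : (1 - t) * m < 1 := by nlinarith
  rw [b.mem_homothety_image_convexHull _ (by linarith), sub_sub_cancel] at hz
  refine or_iff_not_imp_right.2 fun hbad => ?_
  -- At most one coordinate is close to its lower bound. Subtracting `t • y` with `y` in `K` on that
  -- facet leaves it unchanged, while the others have slack `t`.
  have hgood : ∃ k, ∀ l, l ≠ k → (1 - t) * m * (if l = k₀ then 1 else 0) + t ≤ b.coord l z := by
    by_cases h : ∃ k, b.coord k z < (1 - t) * m * (if k = k₀ then 1 else 0) + t
    · obtain ⟨k, hk⟩ := h
      exact ⟨k, fun l hl => not_lt.1 fun hl' => hbad ⟨⟨(l, k), hl⟩, hl', hk⟩⟩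
    · push Not at h
      exact ⟨k₀, fun l _ => h l⟩
  obtain ⟨k, hk⟩ := hgood
  obtain ⟨y, hyK, hy⟩ := htouch k
  have h1t : 0 < 1 - t := by linarith
  have hy1 : ∀ l, b.coord l y ≤ 1 := fun l => by
    rw [← b.sum_coord_apply_eq_one y]
    exact Finset.single_le_sum (f := fun i => b.coord i y) (fun i _ => hK i y hyK)
      (Finset.mem_univ l)
  refine ⟨(1 - t) • AffineMap.lineMap y z (1 - t)⁻¹, Set.smul_mem_smul_set ?_, t • y,
    Set.smul_mem_smul_set hyK, ?_⟩
  · rw [b.mem_homothety_image_convexHull _ (by linarith), sub_sub_cancel]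
    intro l
    rw [AffineMap.apply_lineMap, AffineMap.lineMap_apply_module, smul_eq_mul, smul_eq_mul]
    have key : (1 - t) * (m * (if l = k₀ then 1 else 0)) ≤ b.coord l z - t * b.coord l y := by
      by_cases hl : l = k
      · have := hz l
        rw [hl, hy, ← hl]; linarith
      · have h1 := hk l hl
        have h2 := mul_le_mul_of_nonneg_left (hy1 l) ht0.le
        linarith
    have e : (1 - (1 - t)⁻¹) * b.coord l y + (1 - t)⁻¹ * b.coord l z =
        (b.coord l z - t * b.coord l y) / (1 - t) := by
      field_simp; ring
    rw [e, le_div_iff₀ h1t]; linarith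
  · change (1 - t) • AffineMap.lineMap y z (1 - t)⁻¹ + t • y = z
    rw [AffineMap.lineMap_apply_module, smul_add, smul_smul, smul_smul, mul_inv_cancel₀ h1t.ne',
      add_right_comm, ← add_smul, mul_sub, mul_inv_cancel₀ h1t.ne']
    simp

/-- The dilate of ratio `1 - (1 - t) * m` gains at least `c * t` in volume, while the uncovered part
costs at most `A * t ^ 2`. -/
theorem AffineBasis.exists_measure_lt_measure_add [FiniteDimensional ℝ E] [MeasurableSpace E]
    [BorelSpace E] [Nontrivial E] (μ : Measure E) [μ.IsAddHaarMeasure]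
    (b : AffineBasis ι ℝ E) {K : Set E}
    (hK : ∀ i, ∀ y ∈ K, 0 ≤ b.coord i y) (htouch : ∀ i, ∃ y ∈ K, b.coord i y = 0)
    (k₀ : ι) {m : ℝ} (hm0 : 0 < m) (hm : m ≤ 1 / 2) :
    ∃ t : ℝ, 0 < t ∧ t < 1 ∧
      μ (AffineMap.homothety (b k₀) (1 - m) '' convexHull ℝ (Set.range b)) <
      μ ((1 - t) • (AffineMap.homothety (b k₀) (1 - m) '' convexHull ℝ (Set.range b)) +
        t • K) := by
  choose C hC0 hC using fun p : {p : ι × ι // p.1 ≠ p.2} => b.exists_measure_coord_lt_le μ p.2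
  set A : ℝ := ∑ p, C p with hA
  have hA0 : 0 ≤ A := Finset.sum_nonneg fun p _ => hC0 p
  set V := convexHull ℝ (Set.range b) with hV
  have hVpos : 0 < μ V := Measure.measure_pos_of_nonempty_interior μ
    ⟨_, b.centroid_mem_interior_convexHull⟩
  have hVfin : μ V ≠ ⊤ :=
    ((Set.finite_range b).isCompact_convexHull (𝕜 := ℝ)).measure_lt_top.ne
  set v := (μ V).toReal with hv
  have hv0 : 0 < v := ENNReal.toReal_pos hVpos.ne' hVfin
  have hVv : μ V = ENNReal.ofReal v := (ENNReal.ofReal_toReal hVfin).symm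
  obtain ⟨d, hd⟩ : ∃ d, Module.finrank ℝ E = d + 1 :=
    Nat.exists_eq_succ_of_ne_zero (Module.finrank_pos (R := ℝ) (M := E)).ne'
  set c : ℝ := (1 - m) ^ d * m * v with hc
  have h1m : 0 < 1 - m := by linarith
  have hc0 : 0 < c := by positivity
  -- The second bound gives `A * t < c`; the first gives `∑ l, a l + 2 * t < 1`.
  set t : ℝ := min (1 / 8) (c / (2 * (A + 1))) with ht
  have ht0 : 0 < t := lt_min (by norm_num) (by positivity)
  have ht8 : t ≤ 1 / 8 := min_le_left _ _
  have htc : A * t < c := by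
    have : t ≤ c / (2 * (A + 1)) := min_le_right _ _
    rw [le_div_iff₀ (by positivity)] at this
    nlinarith
  refine ⟨t, ht0, by linarith, ?_⟩
  set L := (1 - t) • (AffineMap.homothety (b k₀) (1 - m) '' V) + t • K with hL
  let a : ι → ℝ := fun l => (1 - t) * m * (if l = k₀ then 1 else 0)
  have htm : 0 ≤ (1 - t) * m := mul_nonneg (by linarith) hm0.le
  have htm' : (1 - t) * m ≤ 1 / 2 := by nlinarith
  have ha0 : ∀ l, 0 ≤ a l := fun l => mul_nonneg htm (by split_ifs <;> norm_num)
  have hasum : ∑ l, a l + 2 * t < 1 := by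
    have : ∑ l, a l = (1 - t) * m := by simp [a]
    rw [this]; linarith
  set R := AffineMap.homothety (b k₀) (1 - (1 - t) * m) '' V with hR
  have hcover : R ⊆ L ∪ ⋃ p : {p : ι × ι // p.1 ≠ p.2},
      {z | (∀ l, a l ≤ b.coord l z ∧ b.coord l z ≤ a l + 1) ∧
        b.coord p.1.1 z < a p.1.1 + t ∧ b.coord p.1.2 z < a p.1.2 + t} := by
    intro z hz
    rcases b.mem_add_or_exists_coord_lt hK htouch k₀ hm0.le (by linarith) ht0 (by linarith) hz
      with h | ⟨p, hp⟩
    · exact Or.inl h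
    · refine Or.inr (Set.mem_iUnion.2 ⟨p, ?_, hp⟩)
      rw [hR, b.mem_homothety_image_convexHull _ (by linarith), sub_sub_cancel] at hz
      refine fun l => ⟨hz l, ?_⟩
      have : b.coord l z ≤ 1 := by
        rw [← b.sum_coord_apply_eq_one z]
        exact Finset.single_le_sum (f := fun i => b.coord i z)
          (fun i _ => (ha0 i).trans (hz i)) (Finset.mem_univ l)
      linarith [ha0 l]
  have hle : μ R ≤ μ L + ENNReal.ofReal (A * t ^ 2) := by
    refine (measure_mono hcover).trans ((measure_union_le _ _).trans ?_)
    gcongr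
    refine (measure_iUnion_fintype_le _ _).trans ?_
    rw [hA, Finset.sum_mul, ENNReal.ofReal_sum_of_nonneg fun p _ =>
      mul_nonneg (hC0 p) (sq_nonneg t)]
    exact Finset.sum_le_sum fun p _ => hC p a t ht0.le hasum
  by_contra hcon
  rw [not_lt] at hcon
  have hle' := hle.trans (add_le_add_left hcon _)
  have hρ : 0 < 1 - (1 - t) * m := by linarith
  rw [hR, Measure.addHaar_image_homothety, Measure.addHaar_image_homothety, hVv, hd,
    abs_of_pos (pow_pos hρ _), abs_of_pos (pow_pos h1m _),
    ← ENNReal.ofReal_mul (by positivity), ← ENNReal.ofReal_mul (by positivity),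
    ← ENNReal.ofReal_add (by positivity) (by positivity),
    ENNReal.ofReal_le_ofReal_iff (by positivity)] at hle'
  have hpow : (1 - m) ^ (d + 1) + (1 - m) ^ d * (t * m) ≤ (1 - (1 - t) * m) ^ (d + 1) := by
    have h1 : (1 - m) ^ d ≤ (1 - (1 - t) * m) ^ d :=
      pow_le_pow_left₀ h1m.le (by nlinarith) d
    have h2 := mul_le_mul_of_nonneg_right h1 hρ.le
    rw [pow_succ, pow_succ]
    linarith
  have h3 := mul_le_mul_of_nonneg_right hpow hv0.le
  have h4 : c * t ≤ A * t * t := by rw [hc]; linarith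
  exact absurd (le_of_mul_le_mul_right h4 ht0) (not_le.2 htc)

end

/-! ### Compactness, projections and assembly -/

theorem exists_pos_le_coord_add_coord {ι E : Type*} [Finite ι] [NormedAddCommGroup E]
    [NormedSpace ℝ E] [FiniteDimensional ℝ E] (b : AffineBasis ι ℝ E) {K : Set E}
    (hK : IsCompact K) (hpos : ∀ i j, i ≠ j → ∀ y ∈ K, 0 < b.coord i y + b.coord j y) :
    ∃ m : ℝ, 0 < m ∧ m ≤ 1 / 2 ∧
      ∀ i j, i ≠ j → ∀ y ∈ K, m ≤ b.coord i y + b.coord j y := by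
  have h : ∀ᶠ m : ℝ in nhdsWithin 0 (Set.Ioi 0), ∀ i j, i ≠ j → ∀ y ∈ K,
      m ≤ b.coord i y + b.coord j y := by
    refine Filter.eventually_all.2 fun i => Filter.eventually_all.2 fun j =>
      Filter.eventually_all.2 fun hij => ?_
    rcases K.eq_empty_or_nonempty with rfl | hne
    · simp
    obtain ⟨y₀, hy₀, hmin⟩ := hK.exists_isMinOn hne ((continuous_barycentric_coord b i).add
      (continuous_barycentric_coord b j)).continuousOn
    filter_upwards [Ioc_mem_nhdsGT (hpos i j hij y₀ hy₀)] with m hm y hy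
    exact hm.2.trans (hmin hy)
  obtain ⟨m, hm, hm'⟩ := (h.and (Ioc_mem_nhdsGT (show (0 : ℝ) < 1 / 2 by norm_num))).exists
  exact ⟨m, hm'.1, hm'.2, hm⟩

theorem exists_affineBasis_mem_of_measure_pos {E : Type*} [NormedAddCommGroup E]
    [NormedSpace ℝ E] [FiniteDimensional ℝ E] [MeasurableSpace E] [BorelSpace E] (μ : Measure E)
    [μ.IsAddHaarMeasure] {n : ℕ} (hn : Module.finrank ℝ E = n) {K : Set E} (hK : 0 < μ K) :
    ∃ β : AffineBasis (Fin (n + 1)) ℝ E, ∀ i, β i ∈ K := by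
  have htop : affineSpan ℝ K = ⊤ := by
    by_contra h
    exact hK.ne' (measure_mono_null (subset_affineSpan ℝ K)
      (Measure.addHaar_affineSubspace μ _ h))
  obtain ⟨s, hs, b, hb⟩ := AffineBasis.exists_affine_subbasis htop
  have : Finite s := finite_of_fin_dim_affineIndependent ℝ b.ind
  have := Fintype.ofFinite s
  have hcard : Fintype.card s = n + 1 := by rw [b.card_eq_finrank_add_one, hn]
  refine ⟨b.reindex (Fintype.equivFinOfCardEq hcard), fun i => ?_⟩
  rw [AffineBasis.reindex_apply, hb]
  exact hs (Subtype.coe_prop _)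

/-- The projection kills `u`, so the slide `s` may depend on the point; only `v` must be common.
Convexity of `M` then absorbs the Minkowski combination. -/
theorem shadowsContainTranslates_of_slide {n : ℕ} {M K : Set (EuclideanSpace ℝ (Fin n))}
    (hM : Convex ℝ M) {t : ℝ} (ht0 : 0 ≤ t) (ht1 : t ≤ 1)
    (h : ∀ u : EuclideanSpace ℝ (Fin n), u ≠ 0 → ∃ v, ∀ y ∈ K, ∃ s : ℝ, y + s • u - v ∈ M) :
    ShadowsContainTranslates M ((1 - t) • M + t • K) := by
  intro u hu
  obtain ⟨v, hv⟩ := h u (fun h0 => by simp [h0] at hu)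
  set P := (Submodule.span ℝ {u})ᗮ.starProjection with hP
  have hPu : P u = 0 := by
    rw [hP, Submodule.starProjection_apply_eq_zero_iff, Submodule.orthogonal_orthogonal]
    exact Submodule.mem_span_singleton_self u
  refine ⟨-(t • P v), Submodule.neg_mem _ (Submodule.smul_mem _ _
    (Submodule.starProjection_apply_mem _ _)), ?_⟩
  rintro _ ⟨_, ⟨_, ⟨x, hx, rfl⟩, _, ⟨y, hy, rfl⟩, rfl⟩, rfl⟩
  obtain ⟨s, hs⟩ := hv y hy
  refine ⟨(1 - t) • x + t • (y + s • u - v), hM hx hs (by linarith) ht0 (by ring), ?_⟩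
  change P _ = P ((1 - t) • x + t • y) + _
  simp only [map_add, map_sub, map_smul, hPu, smul_zero, add_zero]
  module

theorem corollary3p2 (n : ℕ) (hn : 1 ≤ n)
    (K : Set (EuclideanSpace ℝ (Fin n))) (hKcompact : IsCompact K) (hKconvex : Convex ℝ K)
    (hKvol : 0 < volume K) :
    ∃ (T : Affine.Simplex ℝ (EuclideanSpace ℝ (Fin n)) n) (t : ℝ), 0 < t ∧ t < 1 ∧
      ShadowsContainTranslates (convexHull ℝ (Set.range T.points))
        ((1 - t) • convexHull ℝ (Set.range T.points) + t • K) ∧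
      volume (convexHull ℝ (Set.range T.points)) <
        volume ((1 - t) • convexHull ℝ (Set.range T.points) + t • K) := by
  obtain ⟨d, rfl⟩ : ∃ d, n = d + 1 := ⟨n - 1, by omega⟩
  obtain ⟨β, hβ⟩ := exists_affineBasis_mem_of_measure_pos volume finrank_euclideanSpace_fin hKvol
  obtain ⟨b, hK, htouch, hpair⟩ := exists_circumscribed_affineBasis hKcompact β hβ
  obtain ⟨m, hm0, hm, hmK⟩ := exists_pos_le_coord_add_coord b hKcompact hpair
  obtain ⟨t, ht0, ht1, hvol⟩ := b.exists_measure_lt_measure_add volume hK htouch 0 hm0 hm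
  let T : Affine.Simplex ℝ (EuclideanSpace ℝ (Fin (d + 1))) (d + 1) :=
    ⟨AffineMap.homothety (b 0) (1 - m) ∘ b, b.ind.map' _ <| by
      intro x y hxy
      have : (1 - m) ≠ 0 := by linarith
      simpa [AffineMap.homothety_apply, this] using hxy⟩
  have hT : convexHull ℝ (Set.range T.points) =
      AffineMap.homothety (b 0) (1 - m) '' convexHull ℝ (Set.range b) := by
    rw [AffineMap.image_convexHull, ← Set.range_comp]
  refine ⟨T, t, ht0, ht1, ?_, by rwa [hT]⟩
  refine shadowsContainTranslates_of_slide (convex_convexHull ℝ _) ht0.le ht1.le fun u hu => ?_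
  obtain ⟨k, hk⟩ := b.exists_forall_add_smul_mem hK (by linarith) hmK hu
  refine ⟨m • (b k - b 0), fun y hy => ?_⟩
  obtain ⟨s, hs⟩ := hk y hy
  exact ⟨s, hT ▸ b.sub_mem_homothety_image k 0 (by linarith) hs⟩
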